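/- **Definitions.** Let $G$ be a group generated by a set $X$. An element of $G$ is a palindrome (with respect to $X$) if it is the value of a word in the alphabet $X\cup X^{-1}$ that reads the same forwards and backwards. The palindromic length of $g\in G$ is the least $k\ge 0$ such that $g$ is a product of $k$ palindromes, and ${\rm pw}(G,X)\in\{0,1,2,\dots,\infty\}$ is the supremum of the palindromic lengths of the elements of $G$. For $n\ge 1$ the $n$-th nilpotent product of groups $A,B$ is $$A(n)B=(A*B)\big/\big([A,B]\cap\gamma_{n+1}(A*B)\big),$$ where $[A,B]$ is the Cartesian subgroup, i.e. the kernel of $A*B\to A\times B$, and $\gamma_1(A*B)=A*B\ge\gamma_2(A*B)\ge\dots$ is the lower central series. Put $(n)\{A_1,\dots,A_s\}=(\dots(A_1(n)A_2)(n)\dots)(n)A_s$ (the trivial group for $s=0$); it contains the groups $A_i$ canonically. **Theorem.** Let $n,s\ge 1$, let $A_1=\langle X_1\rangle,\dots,A_s=\langle X_s\rangle$ be groups with generating sets $X_i$, and let $G_n=(n)\{A_1,\dots,A_s\}$. Let $C_i$ be the centralizer of $\bigcup_{j\ne i}A_j$ in $A_i$, and let $m_i\in\{0,1,2,\dots,\infty\}$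 be the number of elements of the image of $X_i$ in $A_i/C_i$. Then the following hold. (i) $\displaystyle\max_{1\le i\le s}{\rm pw}(A_i,X_i)\le{\rm pw}\Big(G_n,\bigcup_{i=1}^sX_i\Big)\le\sum_{i=1}^s{\rm pw}(A_i,X_i)+3\sum_{i=1}^sm_i.$ (ii) If $A_k=C_k$ for some $k$, and $G_n(\widehat{A_k})=(n)\{A_1,\dots,\widehat{A_k},\dots,A_s\}$ is the nilpotent product of the remaining factors, then $$\max\Big\{{\rm pw}(A_k,X_k),{\rm pw}\Big(G_n(\widehat{A_k}),\bigcup_{i\ne k}X_i\Big)\Big\}\le{\rm pw}\Big(G_n,\bigcup_{i=1}^sX_i\Big)\le{\rm pw}(A_k,X_k)+{\rm pw}\Big(G_n(\widehat{A_k}),\bigcup_{i\ne k}X_i\Big).$$ (iii) If all $m_i$ are finite (for example, if all $X_i$ are finite), then ${\rm pw}(G_n,\bigcup_iX_i)$ is finite if and only if ${\rm pw}(A_i,X_i)$ is finite for every $i=1,\dots,s$. -/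

import Mathlib

universe u

namespace PalWidth

section Palindromes

variable {G : Type*} [Group G]

/-- `g` is a (word) palindrome with respect to `X`: it is the value of a word in the alphabet
`X ∪ X⁻¹` that reads the same forwards and backwards. -/
def IsPalindrome (X : Set G) (g : G) : Prop :=
  ∃ w : List G, (∀ a ∈ w, a ∈ X ∨ a⁻¹ ∈ X) ∧ w.reverse = w ∧ w.prod = g

/-- The palindromic length of `g` with respect to `X`: the least `k` such that `g` is a product of
`k` palindromes (`⊤` if there is none; the identity has length `0`). -/
noncomputable def palLength (X : Set G) (g : G) : ℕ∞ :=
  ⨅ (L : List G) (_ : (∀ p ∈ L, IsPalindrome X p) ∧ L.prod = g), (L.length : ℕ∞)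

/-- The palindromic width of `G` with respect to `X`. -/
noncomputable def pw (X : Set G) : ℕ∞ := ⨆ g : G, palLength X g

end Palindromes

section NilpotentProduct

/-- The Cartesian subgroup `[A, B]` of the free product `A ∗ B`: the kernel of the canonical
homomorphism `A ∗ B → A × B`. -/
def cartesian (A B : Type u) [Group A] [Group B] : Subgroup (Monoid.Coprod A B) :=
  (Monoid.Coprod.toProd : Monoid.Coprod A B →* A × B).ker

/-- The subgroup `[A, B] ∩ γ_{n+1}(A ∗ B)`. Mathlib numbers the lower central series from `0`,
so `γ_{n+1}` is its term of index `n`. -/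
def nilKernel (n : ℕ) (A B : Type u) [Group A] [Group B] : Subgroup (Monoid.Coprod A B) :=
  cartesian A B ⊓ (⊤ : Subgroup (Monoid.Coprod A B)).lowerCentralSeries n

instance (n : ℕ) (A B : Type u) [Group A] [Group B] : (nilKernel n A B).Normal := by
  unfold nilKernel cartesian
  infer_instance

/-- The `n`-th nilpotent product `A (n) B` of two groups. -/
abbrev NilProd₂ (n : ℕ) (A B : Type u) [Group A] [Group B] : Type u :=
  Monoid.Coprod A B ⧸ nilKernel n A B

/-- The `n`-th nilpotent product `(n){A_1, …, A_s} = (…(A_1 (n) A_2) (n) …) (n) A_s`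
(the trivial group if there are no factors). -/
def NilProd (n : ℕ) : (s : ℕ) → (Fin s → GrpCat.{u}) → GrpCat.{u}
  | 0, _ => GrpCat.of PUnit
  | 1, A => A 0
  | s + 2, A => GrpCat.of (NilProd₂ n (NilProd n (s + 1) fun i => A i.castSucc) (A (Fin.last _)))

/-- The canonical homomorphism of the factor `A_i` to the nilpotent product. -/
def incl (n : ℕ) : (s : ℕ) → (A : Fin s → GrpCat.{u}) → (i : Fin s) → (A i →* NilProd n s A)
  | 0, _, i => i.elim0
  | 1, A, i => Fin.lastCases (motive := fun i : Fin 1 => A i →* A 0)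
      (MonoidHom.id (A 0)) (fun j => j.elim0) i
  | s + 2, A, i => Fin.lastCases (motive := fun i : Fin (s + 2) => A i →*
        NilProd₂ n (NilProd n (s + 1) fun i => A i.castSucc) (A (Fin.last _)))
      ((QuotientGroup.mk' _).comp Monoid.Coprod.inr)
      (fun j => ((QuotientGroup.mk' _).comp Monoid.Coprod.inl).comp
        (incl n (s + 1) (fun i => A i.castSucc) j)) i

variable (n : ℕ) {s : ℕ} (A : Fin s → GrpCat.{u})

/-- The union of the sets `X_i`, as a subset of the nilpotent product. -/
def unionGens (X : ∀ i, Set (A i)) : Set (NilProd n s A) :=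
  ⋃ i, incl n s A i '' X i

/-- `C_i`: the centralizer, in `A_i`, of all the other factors of the nilpotent product. -/
def factorCentralizer (i : Fin s) : Subgroup (A i) :=
  (Subgroup.centralizer (⋃ k ∈ {k : Fin s | k ≠ i}, Set.range (incl n s A k))).comap (incl n s A i)

/-- `m_i`: the number of elements of the image of `X_i` in `A_i / C_i`. -/
noncomputable def numGens (X : ∀ i, Set (A i)) (i : Fin s) : ℕ∞ :=
  ((QuotientGroup.mk : A i → A i ⧸ factorCentralizer n A i) '' X i).encard

end NilpotentProduct

end PalWidth

/-!
The lower bounds hold because `(n){A_1, …, A_s}` has retractions onto each factor and onto the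
nilpotent product of all factors but one, and these send generators to generators or to `1`
(`pw_le_of_surjective`). They come from a universal property (`exists_nilProd_lift`): homomorphisms
`fᵢ : Aᵢ →* P` extend to the nilpotent product if there are normal subgroups `Kᵢ` of `P` that
contain `fⱼ(Aⱼ)` for all `j ≠ i` and whose intersection meets `γ_{n+1}(P)` trivially.

For the upper bound in (i), let `D` be the kernel of the projection `toPi` of the nilpotent product
`G` to the direct product of the factors. Every element of `G` is `a_1 ⋯ a_s d` with `aᵢ ∈ Aᵢ` and
`d ∈ D`, and `aᵢ` costs at most `pw(Aᵢ, Xᵢ)` palindromes. Since `D ∩ γ_{n+1}(G) = 1`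
(`eq_one_of_toPi_eq_one`) and `D ≤ γ_2(G)`, the series `D, [D, G], [[D, G], G], …` reaches `1`. Each
quotient of consecutive terms is central and generated by commutators `[x, h]` with `x` in some
`Xᵢ`, and these commutators depend only on the class of `x` modulo `Cᵢ`, because `Cᵢ` centralizes
the whole kernel of `G → Aᵢ` (`commute_of_mem_factorCentralizer`); the point here is that `Cᵢ` is
normal, by functoriality. The commutators are multiplicative in `h` modulo the next term, so going
down the series one can correct a product of commutators, keeping a single factor `[x, g_x]` for
each representative `x` (`exists_prod_commutator_eq`). Finally each `[x, g]` is a product of three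
palindromes (`palLength_commutator_le`).

If `A_k = C_k`, then `G` is the product of `A_k` and of the image of the nilpotent product of the
other factors, which gives the upper bound in (ii).
-/

namespace PalWidth

open scoped commutatorElement

/-! ### Palindromic length -/

section PalindromicLength

variable {G H : Type*} [Group G] [Group H]

theorem IsPalindrome.map {X : Set G} {Y : Set H} (φ : G →* H)
    (hφ : ∀ x ∈ X, φ x ∈ Y ∨ φ x = 1) {g : G} (hg : IsPalindrome X g) :
    IsPalindrome Y (φ g) := by
  classical
  obtain ⟨w, hw, hrev, rfl⟩ := hg
  refine ⟨(w.map φ).filter (fun a => a ≠ 1), ?_, ?_, ?_⟩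
  · intro a ha
    obtain ⟨ha, h1⟩ := List.mem_filter.1 ha
    obtain ⟨b, hb, rfl⟩ := List.mem_map.1 ha
    have h1 : φ b ≠ 1 := by simpa using h1
    rcases hw b hb with h | h
    · exact Or.inl ((hφ b h).resolve_right h1)
    · refine Or.inr ?_
      have := hφ _ h
      rw [map_inv] at this
      exact this.resolve_right (by simpa using h1)
  · rw [← List.filter_reverse, ← List.map_reverse, hrev]
  · rw [map_list_prod]
    generalize w.map φ = l
    induction l with
    | nil => rfl
    | cons a l ih => by_cases h : a = 1 <;> simp_all

theorem IsPalindrome.inv {X : Set G} {g : G} (hg : IsPalindrome X g) :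
    IsPalindrome X g⁻¹ := by
  obtain ⟨w, hw, hrev, rfl⟩ := hg
  refine ⟨w.map (·⁻¹), ?_, ?_, ?_⟩
  · intro a ha
    obtain ⟨b, hb, rfl⟩ := List.mem_map.1 ha
    simpa using (hw b hb).symm
  · rw [← List.map_reverse, hrev]
  · rw [List.prod_inv_reverse, ← List.map_reverse, hrev]

theorem palLength_le_length {X : Set G} {g : G} (L : List G) (hL : ∀ p ∈ L, IsPalindrome X p)
    (hg : L.prod = g) : palLength X g ≤ L.length :=
  iInf₂_le L ⟨hL, hg⟩

theorem palLength_eq_top_or_exists (X : Set G) (g : G) :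
    palLength X g = ⊤ ∨ ∃ L : List G, (∀ p ∈ L, IsPalindrome X p) ∧ L.prod = g ∧
      palLength X g = L.length := by
  by_cases h : ∃ L : List G, (∀ p ∈ L, IsPalindrome X p) ∧ L.prod = g
  · right
    have : Nonempty {L : List G // (∀ p ∈ L, IsPalindrome X p) ∧ L.prod = g} :=
      ⟨⟨h.choose, h.choose_spec⟩⟩
    have hinf : palLength X g =
        ⨅ L : {L : List G // (∀ p ∈ L, IsPalindrome X p) ∧ L.prod = g}, (L.1.length : ℕ∞) := by
      rw [iInf_subtype]; rfl
    obtain ⟨L, hL⟩ := ciInf_mem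
      (fun L : {L : List G // (∀ p ∈ L, IsPalindrome X p) ∧ L.prod = g} => (L.1.length : ℕ∞))
    exact ⟨L.1, L.2.1, L.2.2, hinf.trans hL.symm⟩
  · left
    refine iInf₂_eq_top.2 fun L hL => absurd ⟨L, hL⟩ h

theorem palLength_map_le {X : Set G} {Y : Set H} (φ : G →* H)
    (hφ : ∀ x ∈ X, φ x ∈ Y ∨ φ x = 1) (g : G) : palLength Y (φ g) ≤ palLength X g := by
  rcases palLength_eq_top_or_exists X g with h | ⟨L, hL, rfl, h⟩
  · simp [h]
  · rw [h]
    refine (palLength_le_length (L.map φ) ?_ (map_list_prod φ L).symm).trans (by simp)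
    intro p hp
    obtain ⟨q, hq, rfl⟩ := List.mem_map.1 hp
    exact (hL q hq).map φ hφ

theorem palLength_le_pw (X : Set G) (g : G) : palLength X g ≤ pw X :=
  le_iSup (palLength X) g

/-- An epimorphism that sends each generator to a generator or to `1` does not increase the
palindromic width. -/
theorem pw_le_of_surjective {X : Set G} {Y : Set H} (φ : G →* H)
    (hφ : ∀ x ∈ X, φ x ∈ Y ∨ φ x = 1) (hs : Function.Surjective φ) : pw Y ≤ pw X := by
  refine iSup_le fun h => ?_
  obtain ⟨g, rfl⟩ := hs h
  exact (palLength_map_le φ hφ g).trans (palLength_le_pw X g)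

theorem palLength_mul_le (X : Set G) (g h : G) :
    palLength X (g * h) ≤ palLength X g + palLength X h := by
  rcases palLength_eq_top_or_exists X g with h₁ | ⟨L, hL, rfl, h₁⟩
  · simp [h₁]
  rcases palLength_eq_top_or_exists X h with h₂ | ⟨M, hM, rfl, h₂⟩
  · simp [h₂]
  rw [h₁, h₂]
  refine (palLength_le_length (L ++ M) ?_ List.prod_append).trans (by simp)
  intro p hp
  rcases List.mem_append.1 hp with hp | hp
  exacts [hL p hp, hM p hp]

theorem palLength_list_prod_le (X : Set G) (L : List G) :
    palLength X L.prod ≤ (L.map (palLength X)).sum := by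
  induction L with
  | nil => exact palLength_le_length [] (by simp) rfl
  | cons a L ih =>
    simp only [List.prod_cons, List.map_cons, List.sum_cons]
    exact (palLength_mul_le X _ _).trans (by gcongr)

/-- If a word `w` has value `g` and its reverse has value `r`, then
`[x, g] = x · (g x⁻¹ r) · (g r)⁻¹` is a product of three palindromes. -/
theorem palLength_commutator_le {X : Set G} (hX : Subgroup.closure X = ⊤) {x : G} (hx : x ∈ X)
    (g : G) : palLength X ⁅x, g⁆ ≤ 3 := by
  have hg : g ∈ Subgroup.closure X := hX ▸ Subgroup.mem_top g
  rw [← Subgroup.mem_toSubmonoid, Subgroup.closure_toSubmonoid] at hg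
  obtain ⟨w, hw, rfl⟩ := Submonoid.exists_list_of_mem_closure hg
  have hw : ∀ a ∈ w, a ∈ X ∨ a⁻¹ ∈ X := hw
  have h₁ : IsPalindrome X x := ⟨[x], by simp [hx], rfl, by simp⟩
  have h₂ : IsPalindrome X (w.prod * x⁻¹ * w.reverse.prod) := by
    refine ⟨w ++ x⁻¹ :: w.reverse, ?_, by simp, by simp [mul_assoc]⟩
    intro a ha
    simp only [List.mem_append, List.mem_cons, List.mem_reverse] at ha
    rcases ha with ha | rfl | ha
    · exact hw a ha
    · simp [hx]
    · exact hw a ha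
  have h₃ : IsPalindrome X (w.prod * w.reverse.prod) := by
    refine ⟨w ++ w.reverse, ?_, by simp, by simp⟩
    intro a ha
    simp only [List.mem_append, List.mem_reverse, or_self] at ha
    exact hw a ha
  refine (palLength_le_length
    [x, w.prod * x⁻¹ * w.reverse.prod, (w.prod * w.reverse.prod)⁻¹] ?_ ?_).trans (by norm_num)
  · have h₄ := h₃.inv
    simp_all
  · simp only [List.prod_cons, List.prod_nil, commutatorElement_def]
    group

end PalindromicLength

/-! ### Products of commutators modulo a central subgroup -/

section Commutators

variable {G : Type*} [Group G] {E M F Y R : Subgroup G}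

/-- If `[M, G] ≤ E`, then the elements of `M` are central modulo `E`. -/
theorem mk_commute_of_commutator_le [E.Normal] (hME : ⁅M, (⊤ : Subgroup G)⁆ ≤ E) {m : G}
    (hm : m ∈ M) (g : G ⧸ E) : Commute (m : G ⧸ E) g := by
  induction g using QuotientGroup.induction_on with
  | H g =>
    have h := hME (Subgroup.commutator_mem_commutator hm (Subgroup.mem_top g))
    rw [← QuotientGroup.eq_one_iff, ← QuotientGroup.mk'_apply, map_commutatorElement] at h
    exact (commutatorElement_eq_one_iff_commute).1 h

theorem commutatorElement_mul_left_of_commute {a b c : G} (h : Commute ⁅b, c⁆ a) :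
    ⁅a * b, c⁆ = ⁅b, c⁆ * ⁅a, c⁆ := by
  have : ⁅a * b, c⁆ = a * ⁅b, c⁆ * a⁻¹ * ⁅a, c⁆ := by simp only [commutatorElement_def]; group
  rw [this, ← h.eq, mul_inv_cancel_right]

theorem commutatorElement_mul_right_of_commute {a b c : G} (h : Commute ⁅a, c⁆ b) :
    ⁅a, b * c⁆ = ⁅a, b⁆ * ⁅a, c⁆ := by
  have : ⁅a, b * c⁆ = ⁅a, b⁆ * (b * ⁅a, c⁆ * b⁻¹) := by simp only [commutatorElement_def]; group
  rw [this, ← h.eq, mul_inv_cancel_right]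

/-- Modulo `E`, the commutator `[y, h]` with values in the central subgroup `M / E` is
multiplicative in `y`, so it suffices to know it on generators of `Y`. -/
theorem commutator_mem_of_closure [E.Normal] (hME : ⁅M, (⊤ : Subgroup G)⁆ ≤ E)
    (hYF : ⁅Y, F⁆ ≤ M) (hER : E ≤ R) {S : Set G} (hS : Subgroup.closure S = Y)
    (h : ∀ y ∈ S, ∀ f ∈ F, ⁅y, f⁆ ∈ R) : ⁅Y, F⁆ ≤ R := by
  have key : ∀ a b : G, (a : G ⧸ E) = b → a ∈ R → b ∈ R := fun a b hab ha => by
    have := R.mul_mem ha (hER (QuotientGroup.eq.1 hab))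
    simpa using this
  rw [Subgroup.commutator_le]
  intro y hy
  subst hS
  induction hy using Subgroup.closure_induction with
  | mem y hy => exact h y hy
  | one => intro f _; simp [R.one_mem]
  | mul a b ha hb iha ihb =>
    intro f hf
    refine key _ _ ?_ (R.mul_mem (ihb f hf) (iha f hf))
    have hc := mk_commute_of_commutator_le hME
      (hYF (Subgroup.commutator_mem_commutator hb hf)) (a : G ⧸ E)
    rw [← QuotientGroup.mk'_apply, ← QuotientGroup.mk'_apply, map_commutatorElement] at hc
    have := commutatorElement_mul_left_of_commute hc
    simp only [← map_mul, ← map_commutatorElement] at this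
    exact this.symm
  | inv a ha iha =>
    intro f hf
    refine key _ _ ?_ (R.inv_mem (iha f hf))
    have hc := mk_commute_of_commutator_le hME
      (hYF (Subgroup.commutator_mem_commutator ha hf)) ((a⁻¹ : G) : G ⧸ E)
    rw [← QuotientGroup.mk'_apply, ← QuotientGroup.mk'_apply, map_commutatorElement] at hc
    have := commutatorElement_mul_left_of_commute hc
    simp only [← map_mul, ← map_commutatorElement, inv_mul_cancel, commutatorElement_one_left,
      map_one] at this
    rw [map_mul] at this
    exact inv_eq_of_mul_eq_one_right this.symm

theorem prod_map_update_mul_of_commute {ι : Type*} [DecidableEq ι] (f : ι → G) {j : ι} {z : G}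
    (hz : ∀ g, Commute z g) (l : List ι) (hl : l.Nodup) (hj : j ∈ l) :
    (l.map (Function.update f j (f j * z))).prod = (l.map f).prod * z := by
  induction l with
  | nil => simp at hj
  | cons i l ih =>
    obtain ⟨hi, hl⟩ := List.nodup_cons.1 hl
    rcases List.mem_cons.1 hj with rfl | hj
    · have : l.map (Function.update f j (f j * z)) = l.map f :=
        List.map_congr_left fun k hk => Function.update_of_ne (by rintro rfl; exact hi hk) _ _
      simp only [List.map_cons, List.prod_cons, Function.update_self, this]
      rw [mul_assoc, mul_assoc, (hz _).eq]
    · have hij : i ≠ j := fun h => hi (h ▸ hj)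
      simp only [List.map_cons, List.prod_cons, Function.update_of_ne hij, ih hl hj, mul_assoc]

/-- Modulo `E`, a product `∏ [tᵢ, gᵢ]` can absorb any element `e` of the central subgroup
`M / E`, provided `M / E` is generated by commutators `[tᵢ, h]` with `h ∈ Fᵢ`: the factor `[tᵢ, h]`
is absorbed by replacing `gᵢ` with `gᵢ h`. -/
theorem exists_prod_commutator_absorb {ι : Type*} (l : List ι) (hl : l.Nodup)
    (hmem : ∀ i, i ∈ l) (t : ι → G) (N F : ι → Subgroup G) (hFN : ∀ i, F i ≤ N i) [E.Normal]
    (hME : ⁅M, (⊤ : Subgroup G)⁆ ≤ E) (hFM : ∀ i, ∀ f ∈ F i, ⁅t i, f⁆ ∈ M)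
    (hM : M ≤ Subgroup.closure {x | ∃ i, ∃ f ∈ F i, ⁅t i, f⁆ = x} ⊔ E) (e : G) (he : e ∈ M)
    (g : ι → G) (hg : ∀ i, g i ∈ N i) :
    ∃ g' : ι → G, (∀ i, g' i ∈ N i) ∧
      (((l.map fun i => ⁅t i, g i⁆).prod * e : G) : G ⧸ E) =
        ((l.map fun i => ⁅t i, g' i⁆).prod : G) := by
  classical
  -- The effect of multiplying the `i`-th argument by an element of `F i`.
  have step : ∀ i, ∀ f ∈ F i, ∀ g : ι → G, (∀ i, g i ∈ N i) → ∃ g' : ι → G, (∀ i, g' i ∈ N i) ∧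
      (((l.map fun i => ⁅t i, g i⁆).prod * ⁅t i, f⁆ : G) : G ⧸ E) =
        ((l.map fun i => ⁅t i, g' i⁆).prod : G) := by
    intro i f hf g hg
    refine ⟨Function.update g i (g i * f), ?_, ?_⟩
    · intro k
      by_cases hk : k = i
      · subst hk
        simpa using (N k).mul_mem (hg k) (hFN k hf)
      · simpa [hk] using hg k
    · have hz := mk_commute_of_commutator_le hME (hFM i f hf)
      have hz' := hz (g i : G ⧸ E)
      rw [← QuotientGroup.mk'_apply, ← QuotientGroup.mk'_apply, map_commutatorElement] at hz'
      have hc := commutatorElement_mul_right_of_commute hz'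
      simp only [← map_mul, ← map_commutatorElement] at hc
      have hp := prod_map_update_mul_of_commute (fun k => ((⁅t k, g k⁆ : G) : G ⧸ E)) (j := i) hz
        l hl (hmem i)
      rw [← QuotientGroup.mk'_apply, ← QuotientGroup.mk'_apply, map_mul, map_list_prod,
        map_list_prod, List.map_map, List.map_map]
      refine hp.symm.trans ?_
      congr 1
      refine List.map_congr_left fun k _ => ?_
      by_cases hk : k = i
      · subst hk
        simp only [Function.comp_apply, Function.update_self]
        exact hc.symm
      · simp [hk]
  have hinv : ∀ i, ∀ f ∈ F i, ((⁅t i, f⁆⁻¹ : G) : G ⧸ E) = (⁅t i, f⁻¹⁆ : G) := by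
    intro i f hf
    have hz := mk_commute_of_commutator_le hME (hFM i f hf) ((f⁻¹ : G) : G ⧸ E)
    rw [← QuotientGroup.mk'_apply, ← QuotientGroup.mk'_apply, map_commutatorElement] at hz
    have hc := commutatorElement_mul_right_of_commute hz
    simp only [← map_mul, ← map_commutatorElement, inv_mul_cancel, commutatorElement_one_right,
      map_one] at hc
    rw [map_mul] at hc
    exact inv_eq_of_mul_eq_one_left hc.symm
  obtain ⟨c, hc, z, hz, rfl⟩ := Subgroup.mem_sup_of_normal_right.1 (hM he)
  have hz1 : (z : G ⧸ E) = 1 := (QuotientGroup.eq_one_iff z).2 hz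
  clear he
  have main : ∀ g : ι → G, (∀ i, g i ∈ N i) → ∃ g' : ι → G, (∀ i, g' i ∈ N i) ∧
      (((l.map fun i => ⁅t i, g i⁆).prod * c : G) : G ⧸ E) =
        ((l.map fun i => ⁅t i, g' i⁆).prod : G) := by
    induction hc using Subgroup.closure_induction_right with
    | one => intro g hg; exact ⟨g, hg, by simp⟩
    | mul_right x hx y hy ih =>
      intro g hg
      obtain ⟨g', hg', h⟩ := ih g hg
      obtain ⟨i, f, hf, rfl⟩ := hy
      obtain ⟨g'', hg'', h'⟩ := step i f hf g' hg'
      refine ⟨g'', hg'', ?_⟩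
      rw [← h', ← mul_assoc, QuotientGroup.mk_mul, h, QuotientGroup.mk_mul]
    | mul_inv_cancel x hx y hy ih =>
      intro g hg
      obtain ⟨g', hg', h⟩ := ih g hg
      obtain ⟨i, f, hf, rfl⟩ := hy
      obtain ⟨g'', hg'', h'⟩ := step i f⁻¹ ((F i).inv_mem hf) g' hg'
      refine ⟨g'', hg'', ?_⟩
      rw [← h', ← mul_assoc, QuotientGroup.mk_mul, h, QuotientGroup.mk_mul, hinv i f hf]
  obtain ⟨g', hg', h⟩ := main g hg
  refine ⟨g', hg', ?_⟩
  rw [← mul_assoc, QuotientGroup.mk_mul, hz1, mul_one, h]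

/-- The series `D, [D, G], [[D, G], G], …`. -/
def iterCommutator (D : Subgroup G) : ℕ → Subgroup G
  | 0 => D
  | k + 1 => ⁅iterCommutator D k, (⊤ : Subgroup G)⁆

instance iterCommutator_normal (D : Subgroup G) [D.Normal] : ∀ k, (iterCommutator D k).Normal
  | 0 => inferInstanceAs D.Normal
  | k + 1 => by
    have := iterCommutator_normal D k
    exact inferInstanceAs (⁅iterCommutator D k, (⊤ : Subgroup G)⁆).Normal

theorem iterCommutator_le (D : Subgroup G) [D.Normal] : ∀ k, iterCommutator D k ≤ D
  | 0 => le_rfl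
  | k + 1 => (Subgroup.commutator_le_left _ _).trans (iterCommutator_le D k)

theorem iterCommutator_le_lowerCentralSeries {D : Subgroup G}
    (hD : D ≤ (⊤ : Subgroup G).lowerCentralSeries 1) :
    ∀ k, iterCommutator D k ≤ (⊤ : Subgroup G).lowerCentralSeries (k + 1)
  | 0 => hD
  | k + 1 => Subgroup.commutator_mono (iterCommutator_le_lowerCentralSeries hD k) le_rfl

/-- Let `D` be a normal subgroup with `[D, G, …, G] = 1`. Suppose that `D / [D, G]` is generated by
commutators `[tᵢ, h]` with `h ∈ Nᵢ`, where `D ≤ Nᵢ` and `[tᵢ, Nᵢ] ≤ D`, and that `G` is generated by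
the `tᵢ` together with elements that centralize `D`. Then every element of `D` is a product
`∏ [tᵢ, gᵢ]` with one factor for each `i`. The product is corrected successively modulo the terms
of the series `D, [D, G], …`. -/
theorem exists_prod_commutator_eq {ι : Type*} (l : List ι) (hl : l.Nodup) (hmem : ∀ i, i ∈ l)
    (t : ι → G) (N : ι → Subgroup G) (D : Subgroup G) [D.Normal] (hDN : ∀ i, D ≤ N i)
    (hND : ∀ i, ∀ f ∈ N i, ⁅t i, f⁆ ∈ D)
    (hD : D ≤ Subgroup.closure {x | ∃ i, ∃ f ∈ N i, ⁅t i, f⁆ = x} ⊔ ⁅D, (⊤ : Subgroup G)⁆)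
    {S : Set G} (hS : Subgroup.closure S = ⊤)
    (hSt : ∀ x ∈ S, ∃ i, ∃ c, (∀ d ∈ D, Commute c d) ∧ x = t i * c)
    {k : ℕ} (hk : iterCommutator D k = ⊥) {d : G} (hd : d ∈ D) :
    ∃ g : ι → G, d = (l.map fun i => ⁅t i, g i⁆).prod := by
  suffices h : ∀ k, ∃ g : ι → G, (∀ i, g i ∈ N i) ∧
      (d : G ⧸ iterCommutator D k) = ((l.map fun i => ⁅t i, g i⁆).prod : G) by
    obtain ⟨g, _, hg⟩ := h k
    refine ⟨g, ?_⟩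
    rw [QuotientGroup.eq, hk, Subgroup.mem_bot, inv_mul_eq_one] at hg
    exact hg
  intro k
  induction k with
  | zero =>
    refine ⟨fun _ => 1, fun i => (N i).one_mem, ?_⟩
    rw [QuotientGroup.eq]
    simp only [commutatorElement_one_right, List.map_const', List.prod_replicate, one_pow, mul_one]
    exact D.inv_mem hd
  | succ k ih =>
    obtain ⟨g, hg, h⟩ := ih
    rw [eq_comm, QuotientGroup.eq] at h
    -- The arguments of the commutators that generate the `k`-th term modulo the next one.
    obtain ⟨F, hFN, hFM, hM⟩ : ∃ F : ι → Subgroup G, (∀ i, F i ≤ N i) ∧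
        (∀ i, ∀ f ∈ F i, ⁅t i, f⁆ ∈ iterCommutator D k) ∧
        iterCommutator D k ≤ Subgroup.closure {x | ∃ i, ∃ f ∈ F i, ⁅t i, f⁆ = x} ⊔
          iterCommutator D (k + 1) := by
      cases k with
      | zero => exact ⟨N, fun _ => le_rfl, hND, hD⟩
      | succ k =>
        refine ⟨fun _ => iterCommutator D k, fun i => (iterCommutator_le D k).trans (hDN i),
          fun i f hf => ?_, ?_⟩
        · rw [iterCommutator, Subgroup.commutator_comm]
          exact Subgroup.commutator_mem_commutator (Subgroup.mem_top _) hf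
        · conv_lhs => rw [iterCommutator, Subgroup.commutator_comm]
          refine commutator_mem_of_closure (M := iterCommutator D (k + 1))
            (E := iterCommutator D (k + 2)) le_rfl ?_ le_sup_right hS ?_
          · rw [Subgroup.commutator_comm]; exact le_rfl
          · intro x hx f hf
            obtain ⟨i, c, hc, rfl⟩ := hSt x hx
            have h1 : ⁅c, f⁆ = 1 :=
              commutatorElement_eq_one_iff_commute.2 (hc f (iterCommutator_le D k hf))
            rw [commutatorElement_mul_left_of_commute (by rw [h1]; exact Commute.one_left _), h1,
              one_mul]
            exact Subgroup.mem_sup_left (Subgroup.subset_closure ⟨i, f, hf, rfl⟩)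
    obtain ⟨g', hg', h'⟩ := exists_prod_commutator_absorb l hl hmem t N F hFN
      (M := iterCommutator D k) (E := iterCommutator D (k + 1)) le_rfl hFM hM _ h g hg
    refine ⟨g', hg', ?_⟩
    rw [← h', mul_inv_cancel_left]

end Commutators

/-! ### The universal property of the nilpotent product -/

section Universal

variable (n : ℕ)

theorem incl_one (A : Fin 1 → GrpCat.{u}) : incl n 1 A 0 = MonoidHom.id (A 0) :=
  Fin.lastCases_last

/-- The quotient map of the free product onto the last stage of the iterated nilpotent product. -/
def stageMk {s : ℕ} (A : Fin (s + 2) → GrpCat.{u}) :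
    Monoid.Coprod (NilProd n (s + 1) fun i => A i.castSucc) (A (Fin.last _)) →*
      NilProd n (s + 2) A :=
  QuotientGroup.mk' (nilKernel n _ _)

theorem stageMk_surjective {s : ℕ} (A : Fin (s + 2) → GrpCat.{u}) :
    Function.Surjective (stageMk n A) :=
  QuotientGroup.mk'_surjective _

theorem stageMk_ker {s : ℕ} (A : Fin (s + 2) → GrpCat.{u}) :
    (stageMk n A).ker = nilKernel n _ _ :=
  QuotientGroup.ker_mk' _

theorem incl_last {s : ℕ} (A : Fin (s + 2) → GrpCat.{u}) :
    incl n (s + 2) A (Fin.last _) = (stageMk n A).comp Monoid.Coprod.inr :=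
  Fin.lastCases_last

theorem incl_castSucc {s : ℕ} (A : Fin (s + 2) → GrpCat.{u}) (i : Fin (s + 1)) :
    incl n (s + 2) A i.castSucc = ((stageMk n A).comp Monoid.Coprod.inl).comp
      (incl n (s + 1) (fun i => A i.castSucc) i) :=
  Fin.lastCases_castSucc _

theorem iSup_range_incl : ∀ (s : ℕ) (A : Fin s → GrpCat.{u}),
    ⨆ i, (incl n s A i).range = ⊤
  | 0, _ => eq_top_iff.2 fun x _ => by
    obtain rfl : x = 1 := Subsingleton.elim (α := PUnit) _ _
    exact Subgroup.one_mem _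
  | 1, A => by
    refine eq_top_iff.2 fun x _ => Subgroup.mem_iSup_of_mem 0 ?_
    rw [incl_one]
    exact ⟨x, rfl⟩
  | s + 2, A => by
    have ih := iSup_range_incl (s + 1) fun i => A i.castSucc
    rw [eq_top_iff, ← MonoidHom.range_eq_top.2 (stageMk_surjective n A),
      MonoidHom.range_eq_map, ← Monoid.Coprod.range_inl_sup_range_inr, Subgroup.map_sup, sup_le_iff]
    constructor
    · rw [MonoidHom.map_range, MonoidHom.range_eq_map, ← ih, Subgroup.map_iSup, iSup_le_iff]
      intro i
      rw [MonoidHom.map_range, ← incl_castSucc]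
      exact le_iSup (fun i => (incl n (s + 2) A i).range) _
    · rw [MonoidHom.map_range, ← incl_last]
      exact le_iSup (fun i => (incl n (s + 2) A i).range) _

variable {n} {s : ℕ} {A : Fin s → GrpCat.{u}}

theorem closure_iUnion_range_incl :
    Subgroup.closure (⋃ i, Set.range (incl n s A i)) = ⊤ := by
  rw [Subgroup.closure_iUnion, ← iSup_range_incl n s A]
  exact iSup_congr fun i => Subgroup.closure_eq (incl n s A i).range

theorem nilProd_hom_ext {P : Type*} [Monoid P] {f g : NilProd n s A →* P}
    (h : ∀ i, f.comp (incl n s A i) = g.comp (incl n s A i)) : f = g := by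
  refine MonoidHom.eq_of_eqOn_dense closure_iUnion_range_incl ?_
  rintro _ hx
  obtain ⟨i, a, rfl⟩ := Set.mem_iUnion.1 hx
  exact DFunLike.congr_fun (h i) a

/-- A family of homomorphisms `fᵢ : Aᵢ →* P` extends to the nilpotent product as soon as there are
normal subgroups `Kᵢ` of `P` such that `fⱼ` maps into `Kᵢ` for `j ≠ i` and `⋂ Kᵢ` meets
`γ_{n+1}(P)` trivially: the image of `[A, B] ∩ γ_{n+1}(A ∗ B)` lies in this intersection. The
extension to the first factors is constructed in the subgroup that they generate, because it lies
in the last `Kᵢ`. -/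
theorem exists_nilProd_lift (n : ℕ) : ∀ (s : ℕ) (A : Fin s → GrpCat.{u}) {P : Type u} [Group P]
    (f : ∀ i, A i →* P) (K : Fin s → Subgroup P) (_ : ∀ i, (K i).Normal)
    (_ : ∀ i j, j ≠ i → (f j).range ≤ K i)
    (_ : ∀ x ∈ (⊤ : Subgroup P).lowerCentralSeries n, (∀ i, x ∈ K i) → x = 1),
    ∃ F : NilProd n s A →* P, ∀ i, F.comp (incl n s A i) = f i
  | 0, _, _, _, _, _, _, _, _ => ⟨1, fun i => i.elim0⟩
  | 1, A, P, _, f, _, _, _, _ => ⟨f 0, fun i => by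
      obtain rfl : i = 0 := Subsingleton.elim _ _
      rw [incl_one]
      rfl⟩
  | s + 2, A, P, _, f, K, hK, hf, h => by
    let Q : Subgroup P := ⨆ i : Fin (s + 1), (f i.castSucc).range
    have hQ : Q ≤ K (Fin.last _) := iSup_le fun i => hf _ _ (Fin.castSucc_lt_last i).ne
    have hfQ : ∀ (i : Fin (s + 1)) (a : A i.castSucc), f i.castSucc a ∈ Q := fun i a =>
      Subgroup.mem_iSup_of_mem i ⟨a, rfl⟩
    obtain ⟨F₀, hF₀⟩ := exists_nilProd_lift n (s + 1) (fun i => A i.castSucc) (P := Q)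
      (fun i => (f i.castSucc).codRestrict Q (hfQ i)) (fun i => (K i.castSucc).subgroupOf Q)
      (fun i => (hK i.castSucc).subgroupOf Q)
      (by
        rintro i j hij _ ⟨a, rfl⟩
        exact hf _ _ (fun h => hij (Fin.castSucc_injective _ h)) ⟨a, rfl⟩)
      (by
        intro x hx hxK
        have hx' : (x : P) ∈ (⊤ : Subgroup P).lowerCentralSeries n := by
          have := Subgroup.mem_map_of_mem Q.subtype hx
          rw [Subgroup.map_lowerCentralSeries] at this
          exact Subgroup.lowerCentralSeries_mono n le_top this
        refine Subtype.ext (h x hx' fun i => ?_)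
        induction i using Fin.lastCases with
        | last => exact hQ x.2
        | cast i => exact hxK i)
    let F₁ : NilProd n (s + 1) (fun i => A i.castSucc) →* P := Q.subtype.comp F₀
    have hF₁ : ∀ i, F₁.comp (incl n (s + 1) _ i) = f i.castSucc := fun i => by
      rw [MonoidHom.comp_assoc, hF₀]
      rfl
    let F₂ := Monoid.Coprod.lift F₁ (f (Fin.last _))
    have hker : nilKernel n _ _ ≤ F₂.ker := by
      rintro w ⟨hw, hwn⟩
      have hw : Monoid.Coprod.toProd w = 1 := hw
      refine h _ ?_ fun i => ?_
      · have := Subgroup.mem_map_of_mem F₂ hwn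
        rw [Subgroup.map_lowerCentralSeries] at this
        exact Subgroup.lowerCentralSeries_mono n le_top this
      · have := hK i
        rw [← QuotientGroup.eq_one_iff]
        induction i using Fin.lastCases with
        | last =>
          have : (QuotientGroup.mk' (K (Fin.last _))).comp F₂ =
              ((QuotientGroup.mk' (K (Fin.last _))).comp (f (Fin.last _))).comp
                Monoid.Coprod.snd := by
            refine Monoid.Coprod.hom_ext ?_ ?_
            · ext x
              simp only [F₂, F₁, MonoidHom.comp_apply, Monoid.Coprod.lift_apply_inl,
                Monoid.Coprod.snd_apply_inl, map_one, QuotientGroup.mk'_apply,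
                QuotientGroup.eq_one_iff]
              exact hQ (F₀ x).2
            · ext x
              simp [F₂]
          refine (DFunLike.congr_fun this w).trans ?_
          have : Monoid.Coprod.snd w = 1 := by
            rw [← Monoid.Coprod.snd_toProd, hw]; rfl
          simp [this]
        | cast i =>
          have : (QuotientGroup.mk' (K i.castSucc)).comp F₂ =
              ((QuotientGroup.mk' (K i.castSucc)).comp F₁).comp Monoid.Coprod.fst := by
            refine Monoid.Coprod.hom_ext ?_ ?_
            · ext x
              simp [F₂]
            · ext x
              simp only [F₂, MonoidHom.comp_apply, Monoid.Coprod.lift_apply_inr,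
                Monoid.Coprod.fst_apply_inr, map_one, QuotientGroup.mk'_apply,
                QuotientGroup.eq_one_iff]
              exact hf _ _ (Fin.castSucc_lt_last i).ne' ⟨x, rfl⟩
          refine (DFunLike.congr_fun this w).trans ?_
          have : Monoid.Coprod.fst w = 1 := by
            rw [← Monoid.Coprod.fst_toProd, hw]; rfl
          simp [this]
    let F : NilProd n (s + 2) A →* P := QuotientGroup.lift (nilKernel n _ _) F₂ hker
    have hF : F.comp (stageMk n A) = F₂ := MonoidHom.ext fun w => QuotientGroup.lift_mk' _ hker w
    refine ⟨F, fun i => ?_⟩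
    induction i using Fin.lastCases with
    | last => rw [incl_last, ← MonoidHom.comp_assoc, hF, Monoid.Coprod.lift_comp_inr]
    | cast i =>
      rw [incl_castSucc, ← MonoidHom.comp_assoc, ← MonoidHom.comp_assoc, hF,
        Monoid.Coprod.lift_comp_inl, hF₁]

end Universal

/-! ### The projection to the direct product -/

section Projection

variable (n : ℕ) {s : ℕ} (A : Fin s → GrpCat.{u})

theorem exists_toPi : ∃ F : NilProd n s A →* ∀ i, A i,
    ∀ i, F.comp (incl n s A i) = MonoidHom.mulSingle (fun i => A i) i := by
  refine exists_nilProd_lift n s A (P := ∀ i, A i) (fun i => MonoidHom.mulSingle (fun i => A i) i)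
    (fun i => (Pi.evalMonoidHom (fun i => A i) i).ker) (fun i => inferInstance) ?_ ?_
  · rintro i j hij _ ⟨a, rfl⟩
    exact Pi.mulSingle_eq_of_ne (M := fun i => A i) hij.symm a
  · intro x _ hx
    exact funext hx

/-- The canonical homomorphism of the nilpotent product to the direct product of the factors. -/
noncomputable def toPi : NilProd n s A →* ∀ i, A i := (exists_toPi n A).choose

variable {A}

@[simp]
theorem toPi_incl (i : Fin s) (a : A i) : toPi n A (incl n s A i a) = Pi.mulSingle i a :=
  DFunLike.congr_fun ((exists_toPi n A).choose_spec i) a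

variable (A)

/-- The defining property of the nilpotent product, for any number of factors: the kernel of the
projection to the direct product meets `γ_{n+1}` trivially. -/
theorem eq_one_of_toPi_eq_one : ∀ (s : ℕ) (A : Fin s → GrpCat.{u}) (x : NilProd n s A)
    (_ : toPi n A x = 1)
    (_ : x ∈ (⊤ : Subgroup (NilProd n s A)).lowerCentralSeries n), x = 1
  | 0, _, _, _, _ => Subsingleton.elim (α := PUnit) _ _
  | 1, A, x, hx, _ => by
    have h := toPi_incl n (A := A) 0 (x : A 0)
    rw [incl_one] at h
    exact (Pi.mulSingle_eq_same (M := fun i => A i) 0 x).symm.trans (congrFun (h.symm.trans hx) 0)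
  | s + 2, A, x, hx, hxn => by
    rw [← Subgroup.map_top_of_surjective _ (stageMk_surjective n A),
      ← Subgroup.map_lowerCentralSeries] at hxn
    obtain ⟨w, hw, rfl⟩ := hxn
    have hfst : ∀ i, toPi n _ (Monoid.Coprod.fst w) i = toPi n A (stageMk n A w) i.castSucc := by
      intro i
      have : ((Pi.evalMonoidHom _ i).comp (toPi n _)).comp Monoid.Coprod.fst =
          ((Pi.evalMonoidHom _ i.castSucc).comp (toPi n A)).comp (stageMk n A) := by
        refine Monoid.Coprod.hom_ext (nilProd_hom_ext fun j => ?_) ?_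
        · ext a
          have := toPi_incl n (A := A) j.castSucc a
          rw [incl_castSucc] at this
          simp only [MonoidHom.comp_apply] at this
          simp only [MonoidHom.comp_apply, this, Monoid.Coprod.fst_apply_inl, toPi_incl,
            Pi.evalMonoidHom_apply]
          by_cases hij : i = j
          · subst hij
            simp
          · rw [Pi.mulSingle_eq_of_ne hij,
              Pi.mulSingle_eq_of_ne (fun h => hij (Fin.castSucc_injective _ h))]
        · ext a
          have := toPi_incl n (A := A) (Fin.last _) a
          rw [incl_last] at this
          simp only [MonoidHom.comp_apply] at this
          simp only [MonoidHom.comp_apply, this, Monoid.Coprod.fst_apply_inr, map_one,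
            Pi.evalMonoidHom_apply]
          rw [Pi.mulSingle_eq_of_ne (Fin.castSucc_lt_last i).ne]
      exact DFunLike.congr_fun this w
    have hsnd : Monoid.Coprod.snd w = toPi n A (stageMk n A w) (Fin.last _) := by
      have : Monoid.Coprod.snd =
          ((Pi.evalMonoidHom _ (Fin.last _)).comp (toPi n A)).comp (stageMk n A) := by
        refine Monoid.Coprod.hom_ext (nilProd_hom_ext fun j => ?_) ?_
        · ext a
          have := toPi_incl n (A := A) j.castSucc a
          rw [incl_castSucc] at this
          simp only [MonoidHom.comp_apply] at this
          simp only [MonoidHom.comp_apply, this, Monoid.Coprod.snd_apply_inl,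
            Pi.evalMonoidHom_apply]
          rw [Pi.mulSingle_eq_of_ne (Fin.castSucc_lt_last j).ne']
        · ext a
          have := toPi_incl n (A := A) (Fin.last _) a
          rw [incl_last] at this
          simp only [MonoidHom.comp_apply] at this
          simp only [MonoidHom.comp_apply, this, Monoid.Coprod.snd_apply_inr,
            Pi.evalMonoidHom_apply]
          rw [Pi.mulSingle_eq_same]
      exact DFunLike.congr_fun this w
    have h1 : Monoid.Coprod.fst w = 1 := by
      refine eq_one_of_toPi_eq_one (s + 1) _ _ (funext fun i => ?_) ?_
      · rw [hfst, hx]; rfl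
      · have := Subgroup.mem_map_of_mem Monoid.Coprod.fst hw
        rw [Subgroup.map_lowerCentralSeries] at this
        exact Subgroup.lowerCentralSeries_mono n le_top this
    have h2 : Monoid.Coprod.snd w = 1 := by rw [hsnd, hx]; rfl
    have : w ∈ (stageMk n A).ker := by
      rw [stageMk_ker]
      exact ⟨Prod.ext (by rw [Monoid.Coprod.fst_toProd, h1]; rfl)
        (by rw [Monoid.Coprod.snd_toProd, h2]; rfl), hw⟩
    exact this

end Projection

/-! ### The centralizers of the factors -/

section Centralizer

variable {n s : ℕ} {A : Fin s → GrpCat.{u}}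

theorem mem_factorCentralizer {i : Fin s} {c : A i} :
    c ∈ factorCentralizer n A i ↔
      ∀ k ≠ i, ∀ b : A k, Commute (incl n s A i c) (incl n s A k b) := by
  simp only [factorCentralizer, Subgroup.mem_comap, Subgroup.mem_centralizer_iff, Set.mem_iUnion,
    Set.mem_ofPred_eq, Set.mem_range]
  constructor
  · intro h k hk b
    exact (h _ ⟨k, hk, b, rfl⟩).symm
  · rintro h _ ⟨k, hk, b, rfl⟩
    exact (h k hk b).symm

/-- Conjugation by `a` on the factor `A_i` and the identity on the other factors extend to an
endomorphism of the nilpotent product, so `C_i` is invariant under conjugation in `A_i`. -/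
instance factorCentralizer_normal (i : Fin s) : (factorCentralizer n A i).Normal := by
  refine ⟨fun c hc a => ?_⟩
  obtain ⟨F, hF⟩ := exists_nilProd_lift n s A
    (fun j => (incl n s A j).comp (MulAut.conj (Pi.mulSingle (M := fun i => A i) i a j)).toMonoidHom)
    (fun j => ((Pi.evalMonoidHom _ j).comp (toPi n A)).ker) (fun j => inferInstance)
    (by
      rintro j k hjk _ ⟨b, rfl⟩
      simp [MonoidHom.mem_ker, Pi.mulSingle_eq_of_ne hjk.symm])
    (fun x hx h => eq_one_of_toPi_eq_one n s A x (funext h) hx)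
  rw [mem_factorCentralizer] at hc ⊢
  intro k hk b
  have h := (hc k hk b).map F
  rw [← MonoidHom.comp_apply, ← MonoidHom.comp_apply, hF, hF] at h
  simpa [Pi.mulSingle_eq_of_ne hk] using h

instance map_factorCentralizer_normal (i : Fin s) :
    ((factorCentralizer n A i).map (incl n s A i)).Normal := by
  refine ⟨fun c hc g => ?_⟩
  have hg : g ∈ ⨆ j, (incl n s A j).range := by rw [iSup_range_incl]; exact Subgroup.mem_top g
  induction hg using Subgroup.iSup_induction' generalizing c with
  | h1 => simpa using hc
  | hmul x y _ _ hx hy =>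
    have := hx _ (hy c hc)
    simpa [mul_assoc] using this
  | hp j g hg =>
    obtain ⟨a, rfl⟩ := hg
    obtain ⟨c, hc, rfl⟩ := hc
    by_cases hj : j = i
    · subst hj
      exact ⟨a * c * a⁻¹, (factorCentralizer_normal j).conj_mem c hc a, by simp⟩
    · refine ⟨c, hc, ?_⟩
      rw [← (mem_factorCentralizer.1 hc j hj a).eq, mul_inv_cancel_right]

/-- The centralizer of `C_i` is normal and contains the factors other than `A_i`, so it contains
the kernel of the projection to `A_i`. -/
theorem commute_of_mem_factorCentralizer {i : Fin s} {c : A i} (hc : c ∈ factorCentralizer n A i)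
    {x : NilProd n s A} (hx : toPi n A x i = 1) : Commute (incl n s A i c) x := by
  let Z : Subgroup (NilProd n s A) :=
    Subgroup.centralizer ((factorCentralizer n A i).map (incl n s A i) : Subgroup _)
  have h : QuotientGroup.mk' Z = ((QuotientGroup.mk' Z).comp (incl n s A i)).comp
      ((Pi.evalMonoidHom _ i).comp (toPi n A)) := by
    refine nilProd_hom_ext fun j => ?_
    ext b
    by_cases hj : j = i
    · subst hj
      simp
    · simp only [MonoidHom.comp_apply, toPi_incl, Pi.evalMonoidHom_apply,
        Pi.mulSingle_eq_of_ne (Ne.symm hj), map_one]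
      rw [QuotientGroup.mk'_apply, QuotientGroup.eq_one_iff]
      rintro _ ⟨c, hc, rfl⟩
      exact mem_factorCentralizer.1 hc j hj b
  have hxZ : x ∈ Z := by
    rw [← QuotientGroup.eq_one_iff]
    refine (DFunLike.congr_fun h x).trans ?_
    simp [hx]
  exact hxZ _ ⟨c, hc, rfl⟩

end Centralizer

/-! ### The Cartesian subgroup of the nilpotent product -/

section Cartesian

variable {n s : ℕ} {A : Fin s → GrpCat.{u}}

/-- The kernel of the projection to the direct product is the smallest normal subgroup modulo which
different factors commute. -/
theorem ker_toPi_le {R : Subgroup (NilProd n s A)} [R.Normal]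
    (h : ∀ i j, i ≠ j → ∀ (a : A i) (b : A j), ⁅incl n s A i a, incl n s A j b⁆ ∈ R) :
    (toPi n A).ker ≤ R := by
  have hcomm : Pairwise fun i j => ∀ (a : A i) (b : A j),
      Commute ((QuotientGroup.mk' R).comp (incl n s A i) a)
        ((QuotientGroup.mk' R).comp (incl n s A j) b) := by
    intro i j hij a b
    have := h i j hij a b
    rwa [← QuotientGroup.eq_one_iff, ← QuotientGroup.mk'_apply, map_commutatorElement,
      commutatorElement_eq_one_iff_commute] at this
  have hmk : QuotientGroup.mk' R = (MonoidHom.noncommPiCoprod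
      (fun i => (QuotientGroup.mk' R).comp (incl n s A i)) hcomm).comp (toPi n A) := by
    refine nilProd_hom_ext fun i => ?_
    ext a
    simp only [MonoidHom.comp_apply, toPi_incl, MonoidHom.noncommPiCoprod_mulSingle]
  intro x hx
  rw [← QuotientGroup.eq_one_iff]
  refine (DFunLike.congr_fun hmk x).trans ?_
  rw [MonoidHom.comp_apply, MonoidHom.mem_ker.1 hx, map_one]

theorem iterCommutator_ker_toPi (n : ℕ) {s : ℕ} (A : Fin s → GrpCat.{u}) :
    iterCommutator (toPi (n + 1) A).ker n = ⊥ := by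
  have h1 : (toPi (n + 1) A).ker ≤ (⊤ : Subgroup (NilProd (n + 1) s A)).lowerCentralSeries 1 :=
    ker_toPi_le fun i j _ a b =>
      Subgroup.commutator_mem_commutator (Subgroup.mem_top _) (Subgroup.mem_top _)
  rw [eq_bot_iff]
  intro x hx
  exact eq_one_of_toPi_eq_one (n + 1) s A x (iterCommutator_le _ n hx)
    (iterCommutator_le_lowerCentralSeries h1 n hx)

variable {X : ∀ i, Set (A i)}

theorem mem_unionGens {i : Fin s} {x : A i} (hx : x ∈ X i) :
    incl n s A i x ∈ unionGens n A X :=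
  Set.mem_iUnion_of_mem i ⟨x, hx, rfl⟩

theorem closure_image_incl (hX : ∀ i, Subgroup.closure (X i) = ⊤) (i : Fin s) :
    Subgroup.closure (incl n s A i '' X i) = (incl n s A i).range := by
  rw [← MonoidHom.map_closure, hX, MonoidHom.range_eq_map]

theorem closure_unionGens (hX : ∀ i, Subgroup.closure (X i) = ⊤) :
    Subgroup.closure (unionGens n A X) = ⊤ := by
  rw [unionGens, Subgroup.closure_iUnion, ← iSup_range_incl n s A]
  exact iSup_congr (closure_image_incl hX)

/-- Every element of the Cartesian subgroup is a product of commutators `[t, g_t]`, one for each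
`t` in a transversal `T_i` of the image of `X_i` in `A_i / C_i`, for all `i`. -/
theorem exists_prod_commutator_of_toPi_eq_one (hn : 1 ≤ n)
    (hX : ∀ i, Subgroup.closure (X i) = ⊤) (T : ∀ i, Set (A i))
    (hT : ∀ i, ∀ x ∈ X i, ∃ t ∈ T i, t⁻¹ * x ∈ factorCentralizer n A i)
    (l : List (Σ i, T i)) (hl : l.Nodup) (hmem : ∀ t, t ∈ l) {d : NilProd n s A}
    (hd : toPi n A d = 1) :
    ∃ g : (Σ i, T i) → NilProd n s A, d = (l.map fun t => ⁅incl n s A t.1 t.2, g t⁆).prod := by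
  obtain ⟨n, rfl⟩ := Nat.exists_eq_add_of_le' hn
  let t : (Σ i, T i) → NilProd (n + 1) s A := fun t => incl (n + 1) s A t.1 t.2
  let p : ∀ i, NilProd (n + 1) s A →* A i := fun i => (Pi.evalMonoidHom _ i).comp (toPi (n + 1) A)
  let D := (toPi (n + 1) A).ker
  have hDp : ∀ i, D ≤ (p i).ker := fun i x hx => congrFun (MonoidHom.mem_ker.1 hx) i
  have hcom : ∀ i (a : A i), ∀ f ∈ (p i).ker, ⁅incl (n + 1) s A i a, f⁆ ∈ D := by
    intro i a f hf
    have hf : toPi (n + 1) A f i = 1 := hf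
    rw [MonoidHom.mem_ker, map_commutatorElement, toPi_incl]
    funext j
    by_cases hj : j = i
    · subst hj
      simp [commutatorElement_def, hf]
    · simp [commutatorElement_def, Pi.mulSingle_eq_of_ne hj]
  have hsplit : ∀ i, ∀ x ∈ X i, ∃ (τ : Σ i, T i) (c : A i), c ∈ factorCentralizer (n + 1) A i ∧
      τ.1 = i ∧ incl (n + 1) s A i x = t τ * incl (n + 1) s A i c := by
    intro i x hx
    obtain ⟨y, hy, hc⟩ := hT i x hx
    exact ⟨⟨i, y, hy⟩, _, hc, rfl, by simp [t]⟩
  let W : Subgroup (NilProd (n + 1) s A) :=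
    Subgroup.closure {x | ∃ τ, ∃ f ∈ (p τ.1).ker, ⁅t τ, f⁆ = x}
  let E : Subgroup (NilProd (n + 1) s A) := ⁅D, (⊤ : Subgroup (NilProd (n + 1) s A))⁆
  have hWD : W ⊔ E ≤ D := by
    refine sup_le ((Subgroup.closure_le D).2 ?_) (Subgroup.commutator_le_left _ _)
    rintro _ ⟨τ, f, hf, rfl⟩
    exact hcom _ _ f hf
  have hnormal : (W ⊔ E).Normal := by
    refine ⟨fun r hr g => ?_⟩
    have : g * r * g⁻¹ = ⁅r, g⁆⁻¹ * r := by simp only [commutatorElement_def]; group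
    rw [this]
    exact (W ⊔ E).mul_mem ((W ⊔ E).inv_mem (Subgroup.mem_sup_right
      (Subgroup.commutator_mem_commutator (hWD hr) (Subgroup.mem_top g)))) hr
  have hD : D ≤ W ⊔ E := by
    refine ker_toPi_le fun i j hij a b => ?_
    have hle : ⁅(incl (n + 1) s A i).range, (p i).ker⁆ ≤ W ⊔ E := by
      refine commutator_mem_of_closure (M := D) (E := E) le_rfl ?_ le_sup_right
        (closure_image_incl hX i) ?_
      · rw [Subgroup.commutator_le]
        rintro _ ⟨a, rfl⟩ f hf
        exact hcom i a f hf
      · rintro _ ⟨x, hx, rfl⟩ f hf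
        obtain ⟨τ, c, hc, rfl, h⟩ := hsplit i x hx
        have h1 := commutatorElement_eq_one_iff_commute.2 (commute_of_mem_factorCentralizer hc hf)
        rw [h, commutatorElement_mul_left_of_commute (by rw [h1]; exact Commute.one_left _), h1,
          one_mul]
        exact Subgroup.mem_sup_left (Subgroup.subset_closure ⟨τ, f, hf, rfl⟩)
    refine hle (Subgroup.commutator_mem_commutator ⟨a, rfl⟩ ?_)
    simp [p, MonoidHom.mem_ker, Pi.mulSingle_eq_of_ne hij]
  refine exists_prod_commutator_eq l hl hmem t (fun τ => (p τ.1).ker) D (fun τ => hDp τ.1)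
    (fun τ f hf => hcom _ _ f hf) hD (closure_unionGens hX) ?_ (iterCommutator_ker_toPi n A) hd
  intro x hx
  obtain ⟨i, y, hy, rfl⟩ := Set.mem_iUnion.1 hx
  obtain ⟨τ, c, hc, -, h⟩ := hsplit i y hy
  exact ⟨τ, _, fun d hd => commute_of_mem_factorCentralizer hc (hDp i hd), h⟩

theorem list_prod_mulSingle_apply {ι : Type*} [DecidableEq ι] {M : ι → Type*} [∀ i, Monoid (M i)]
    (f : ∀ i, M i) (i : ι) (l : List ι) (hl : l.Nodup) :
    (l.map fun j => Pi.mulSingle j (f j)).prod i = if i ∈ l then f i else 1 := by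
  induction l with
  | nil => simp
  | cons j l ih =>
    obtain ⟨hj, hl⟩ := List.nodup_cons.1 hl
    simp only [List.map_cons, List.prod_cons, Pi.mul_apply, ih hl, List.mem_cons]
    by_cases hij : i = j
    · subst hij
      simp [hj]
    · simp [hij]

theorem exists_eq_prod_incl_mul (x : NilProd n s A) :
    ∃ d, toPi n A d = 1 ∧
      x = ((List.finRange s).map fun i => incl n s A i (toPi n A x i)).prod * d := by
  refine ⟨((List.finRange s).map fun i => incl n s A i (toPi n A x i)).prod⁻¹ * x, ?_, by group⟩
  rw [map_mul, map_inv, inv_mul_eq_one, map_list_prod, List.map_map]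
  funext i
  have := list_prod_mulSingle_apply (toPi n A x) i (List.finRange s) (List.nodup_finRange s)
  simpa [Function.comp_def] using this

end Cartesian

/-! ### Bounds for the palindromic width -/

section Width

variable {n s : ℕ} {A : Fin s → GrpCat.{u}} {X : ∀ i, Set (A i)}

theorem palLength_incl_le (i : Fin s) (a : A i) :
    palLength (unionGens n A X) (incl n s A i a) ≤ pw (X i) :=
  (palLength_map_le _ (fun _ hx => Or.inl (mem_unionGens hx)) a).trans (palLength_le_pw _ a)

theorem pw_factor_le (n : ℕ) (X : ∀ i, Set (A i)) (i : Fin s) :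
    pw (X i) ≤ pw (unionGens n A X) := by
  refine pw_le_of_surjective ((Pi.evalMonoidHom _ i).comp (toPi n A)) ?_ fun a =>
    ⟨incl n s A i a, by simp⟩
  intro x hx
  obtain ⟨j, y, hy, rfl⟩ := Set.mem_iUnion.1 hx
  by_cases hj : j = i
  · subst hj
    simp [hy]
  · simp [Pi.mulSingle_eq_of_ne (Ne.symm hj)]

theorem pw_unionGens_le_of_finite (hn : 1 ≤ n) (hX : ∀ i, Subgroup.closure (X i) = ⊤)
    (hfin : ∀ i, numGens n A X i ≠ ⊤) :
    pw (unionGens n A X) ≤ (∑ i, pw (X i)) + 3 * ∑ i, numGens n A X i := by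
  choose T hTX hT using fun i =>
    Set.exists_subset_bijOn (X i) (QuotientGroup.mk : A i → A i ⧸ factorCentralizer n A i)
  have hcard : ∀ i, (T i).encard = numGens n A X i := fun i => by
    rw [numGens, ← (hT i).image_eq, (hT i).injOn.encard_image]
  have : ∀ i, Fintype (T i) := fun i =>
    (Set.encard_ne_top_iff.1 ((hcard i).trans_ne (hfin i))).fintype
  have hrep : ∀ i, ∀ x ∈ X i, ∃ t ∈ T i, t⁻¹ * x ∈ factorCentralizer n A i := fun i x hx => by
    obtain ⟨t, ht, h⟩ := (hT i).surjOn ⟨x, hx, rfl⟩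
    exact ⟨t, ht, QuotientGroup.eq.1 h⟩
  let l : List (Σ i, T i) := Finset.univ.toList
  have hl : (l.length : ℕ∞) = ∑ i, numGens n A X i := by
    simp only [l, Finset.length_toList, Finset.card_univ, Fintype.card_sigma, Nat.cast_sum]
    refine Finset.sum_congr rfl fun i _ => ?_
    rw [← hcard, Set.encard, ENat.card_eq_coe_fintype_card]
  refine iSup_le fun x => ?_
  obtain ⟨d, hd, hx⟩ := exists_eq_prod_incl_mul x
  obtain ⟨g, hg⟩ := exists_prod_commutator_of_toPi_eq_one hn hX T hrep l (Finset.nodup_toList _)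
    (fun t => Finset.mem_toList.2 (Finset.mem_univ t)) hd
  rw [hx]
  refine (palLength_mul_le _ _ _).trans (add_le_add ?_ ?_)
  · refine (palLength_list_prod_le _ _).trans ?_
    rw [List.map_map, Fin.sum_univ_def]
    exact List.sum_le_sum fun i _ => palLength_incl_le i _
  · rw [hg, ← hl]
    refine (palLength_list_prod_le _ _).trans ?_
    rw [List.map_map]
    refine (List.sum_le_card_nsmul _ 3 ?_).trans ?_
    · intro y hy
      obtain ⟨t, -, rfl⟩ := List.mem_map.1 hy
      exact palLength_commutator_le (closure_unionGens hX) (mem_unionGens (hTX _ t.2.2)) _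
    · rw [List.length_map, nsmul_eq_mul, mul_comm]

theorem pw_unionGens_le (hn : 1 ≤ n) (hX : ∀ i, Subgroup.closure (X i) = ⊤) :
    pw (unionGens n A X) ≤ (∑ i, pw (X i)) + 3 * ∑ i, numGens n A X i := by
  by_cases hfin : ∀ i, numGens n A X i ≠ ⊤
  · exact pw_unionGens_le_of_finite hn hX hfin
  · push Not at hfin
    obtain ⟨i, hi⟩ := hfin
    have h : ∑ i, numGens n A X i = ⊤ :=
      top_unique (hi ▸ Finset.single_le_sum (fun _ _ => zero_le) (Finset.mem_univ i))
    rw [h, ENat.mul_top (by norm_num), add_top]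
    exact le_top

end Width

/-! ### Omitting a factor -/

section OmitFactor

variable {n s : ℕ} {A : Fin (s + 1) → GrpCat.{u}} {X : ∀ i, Set (A i)}

/-- The retraction that kills the factor `A_k`. -/
theorem exists_omit (n : ℕ) (A : Fin (s + 1) → GrpCat.{u}) (k : Fin (s + 1)) :
    ∃ F : NilProd n (s + 1) A →* NilProd n s fun j => A (k.succAbove j),
      F.comp (incl n (s + 1) A k) = 1 ∧
      ∀ j, F.comp (incl n (s + 1) A (k.succAbove j)) = incl n s (fun j => A (k.succAbove j)) j := by
  let B : Fin s → GrpCat.{u} := fun j => A (k.succAbove j)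
  let f : ∀ i, A i →* NilProd n s B := Fin.insertNth k 1 fun j => incl n s B j
  let K : Fin (s + 1) → Subgroup (NilProd n s B) :=
    Fin.insertNth k ⊤ fun j => ((Pi.evalMonoidHom _ j).comp (toPi n B)).ker
  have hfk : f k = 1 := Fin.insertNth_apply_same _ _ _
  have hf : ∀ j, f (k.succAbove j) = incl n s B j := fun j => Fin.insertNth_apply_succAbove _ _ _ j
  have hKk : K k = ⊤ := Fin.insertNth_apply_same _ _ _
  have hK : ∀ j, K (k.succAbove j) = ((Pi.evalMonoidHom _ j).comp (toPi n B)).ker := fun j =>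
    Fin.insertNth_apply_succAbove _ _ _ j
  obtain ⟨F, hF⟩ := exists_nilProd_lift n (s + 1) A f K
    (by
      intro i
      rcases Fin.eq_self_or_eq_succAbove k i with rfl | ⟨i, rfl⟩
      · rw [hKk]; infer_instance
      · rw [hK]; infer_instance)
    (by
      rintro i j hij _ ⟨a, rfl⟩
      rcases Fin.eq_self_or_eq_succAbove k i with rfl | ⟨i, rfl⟩
      · rw [hKk]; exact Subgroup.mem_top _
      rcases Fin.eq_self_or_eq_succAbove k j with rfl | ⟨j, rfl⟩
      · rw [hfk]; exact Subgroup.one_mem _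
      have hij : i ≠ j := fun h => hij (by rw [h])
      rw [hK, hf, MonoidHom.mem_ker, MonoidHom.comp_apply, toPi_incl]
      exact Pi.mulSingle_eq_of_ne (M := fun j => B j) hij a)
    (fun x hx h => eq_one_of_toPi_eq_one n s B x (funext fun j => by
      have := h (k.succAbove j)
      rw [hK] at this
      exact this) hx)
  exact ⟨F, (hF k).trans hfk, fun j => (hF _).trans (hf j)⟩

/-- The canonical homomorphism from the nilpotent product of the factors other than `A_k`. The
universal property is applied to the kernel of the projection to `A_k`, where the condition on the
intersection of the normal subgroups need not involve the index `k`. -/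
theorem exists_extend (n : ℕ) (A : Fin (s + 1) → GrpCat.{u}) (k : Fin (s + 1)) :
    ∃ F : (NilProd n s fun j => A (k.succAbove j)) →* NilProd n (s + 1) A,
      (∀ j, F.comp (incl n s (fun j => A (k.succAbove j)) j) =
        incl n (s + 1) A (k.succAbove j)) ∧ ∀ x, toPi n A (F x) k = 1 := by
  let Q : Subgroup (NilProd n (s + 1) A) := ((Pi.evalMonoidHom _ k).comp (toPi n A)).ker
  have hQ : ∀ (j : Fin s) (a : A (k.succAbove j)), incl n (s + 1) A (k.succAbove j) a ∈ Q := by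
    intro j a
    rw [MonoidHom.mem_ker, MonoidHom.comp_apply, toPi_incl]
    exact Pi.mulSingle_eq_of_ne (M := fun j => A j) (Fin.succAbove_ne k j).symm a
  obtain ⟨F, hF⟩ := exists_nilProd_lift n s (fun j => A (k.succAbove j)) (P := Q)
    (fun j => (incl n (s + 1) A (k.succAbove j)).codRestrict Q (hQ j))
    (fun j => (((Pi.evalMonoidHom _ (k.succAbove j)).comp (toPi n A)).ker).subgroupOf Q)
    (fun j => inferInstance)
    (by
      rintro i j hij _ ⟨a, rfl⟩
      rw [Subgroup.mem_subgroupOf, MonoidHom.mem_ker, MonoidHom.comp_apply]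
      refine (congrFun (toPi_incl n (k.succAbove j) a) _).trans ?_
      exact Pi.mulSingle_eq_of_ne (M := fun j => A j)
        (fun h => hij (Fin.succAbove_right_injective h).symm) a)
    (by
      intro x hx h
      refine Subtype.ext (eq_one_of_toPi_eq_one n (s + 1) A x (funext fun i => ?_) ?_)
      · rcases Fin.eq_self_or_eq_succAbove k i with rfl | ⟨i, rfl⟩
        · exact x.2
        · exact h i
      · have := Subgroup.mem_map_of_mem Q.subtype hx
        rw [Subgroup.map_lowerCentralSeries] at this
        exact Subgroup.lowerCentralSeries_mono n le_top this)
  refine ⟨Q.subtype.comp F, fun j => ?_, fun x => (F x).2⟩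
  rw [MonoidHom.comp_assoc, hF]
  rfl

theorem pw_omit_le (n : ℕ) (X : ∀ i, Set (A i)) (k : Fin (s + 1)) :
    pw (unionGens n (fun j => A (k.succAbove j)) fun j => X (k.succAbove j)) ≤
      pw (unionGens n A X) := by
  obtain ⟨F, hFk, hF⟩ := exists_omit n A k
  refine pw_le_of_surjective F ?_ ?_
  · intro x hx
    obtain ⟨i, y, hy, rfl⟩ := Set.mem_iUnion.1 hx
    rcases Fin.eq_self_or_eq_succAbove k i with rfl | ⟨i, rfl⟩
    · exact Or.inr (DFunLike.congr_fun hFk y)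
    · left
      rw [← MonoidHom.comp_apply, hF]
      exact mem_unionGens (A := fun j => A (k.succAbove j)) (X := fun j => X (k.succAbove j)) hy
  · rw [← MonoidHom.range_eq_top, eq_top_iff, ← iSup_range_incl, iSup_le_iff]
    rintro j _ ⟨a, rfl⟩
    exact ⟨incl n (s + 1) A (k.succAbove j) a, DFunLike.congr_fun (hF j) a⟩

/-- If the factor `A_k` is centralized by the other factors, then every element is a product of an
element of `A_k` and an element of the nilpotent product of the other factors. -/
theorem pw_le_of_factorCentralizer_eq_top (X : ∀ i, Set (A i)) {k : Fin (s + 1)}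
    (hk : factorCentralizer n A k = ⊤) :
    pw (unionGens n A X) ≤ pw (X k) +
      pw (unionGens n (fun j => A (k.succAbove j)) fun j => X (k.succAbove j)) := by
  obtain ⟨F, hF, hFk⟩ := exists_extend n A k
  have hsplit : ∀ x : NilProd n (s + 1) A, ∃ a y, x = incl n (s + 1) A k a * F y := by
    intro x
    have hx : x ∈ ⨆ i, (incl n (s + 1) A i).range := by
      rw [iSup_range_incl]; exact Subgroup.mem_top x
    induction hx using Subgroup.iSup_induction' with
    | h1 => exact ⟨1, 1, by simp⟩
    | hmul x x' _ _ hx hx' =>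
      obtain ⟨a, y, rfl⟩ := hx
      obtain ⟨a', y', rfl⟩ := hx'
      have h : Commute (incl n (s + 1) A k a') (F y) :=
        commute_of_mem_factorCentralizer (hk ▸ Subgroup.mem_top a') (hFk y)
      refine ⟨a * a', y * y', ?_⟩
      rw [map_mul, map_mul, mul_assoc, ← mul_assoc (F y), ← h.eq]
      simp only [mul_assoc]
    | hp i x hx =>
      obtain ⟨a, rfl⟩ := hx
      rcases Fin.eq_self_or_eq_succAbove k i with rfl | ⟨i, rfl⟩
      · exact ⟨a, 1, by simp⟩
      · exact ⟨1, incl n s _ i a, by rw [map_one, one_mul, ← MonoidHom.comp_apply, hF]⟩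
  refine iSup_le fun x => ?_
  obtain ⟨a, y, rfl⟩ := hsplit x
  refine (palLength_mul_le _ _ _).trans (add_le_add (palLength_incl_le k a) ?_)
  refine (palLength_map_le F ?_ y).trans (palLength_le_pw _ y)
  intro z hz
  obtain ⟨j, b, hb, rfl⟩ := Set.mem_iUnion.1 hz
  left
  rw [← MonoidHom.comp_apply, hF]
  exact mem_unionGens hb

end OmitFactor

end PalWidth

theorem theorem3p3 (n : ℕ) (hn : 1 ≤ n) (s : ℕ) (A : Fin (s + 1) → GrpCat.{u})
    (X : ∀ i, Set (A i)) (hX : ∀ i, Subgroup.closure (X i) = ⊤) :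
    -- (i)
    ((⨆ i, PalWidth.pw (X i)) ≤ PalWidth.pw (PalWidth.unionGens n A X) ∧
      PalWidth.pw (PalWidth.unionGens n A X) ≤
        (∑ i, PalWidth.pw (X i)) + 3 * (∑ i, PalWidth.numGens n A X i)) ∧
    -- (ii)
    (∀ k : Fin (s + 1), PalWidth.factorCentralizer n A k = ⊤ →
      max (PalWidth.pw (X k))
          (PalWidth.pw (PalWidth.unionGens n (fun j => A (k.succAbove j))
            (fun j => X (k.succAbove j)))) ≤
        PalWidth.pw (PalWidth.unionGens n A X) ∧
      PalWidth.pw (PalWidth.unionGens n A X) ≤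
        PalWidth.pw (X k) +
          PalWidth.pw (PalWidth.unionGens n (fun j => A (k.succAbove j))
            (fun j => X (k.succAbove j)))) ∧
    -- finiteness of the palindromic width
    ((∀ i, PalWidth.numGens n A X i ≠ ⊤) →
      (PalWidth.pw (PalWidth.unionGens n A X) ≠ ⊤ ↔ ∀ i, PalWidth.pw (X i) ≠ ⊤)) := by
  have upper := PalWidth.pw_unionGens_le (X := X) hn hX
  refine ⟨⟨iSup_le (PalWidth.pw_factor_le n X), upper⟩,
    fun k hk => ⟨max_le (PalWidth.pw_factor_le n X k) (PalWidth.pw_omit_le n X k),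
      PalWidth.pw_le_of_factorCentralizer_eq_top X hk⟩, fun hm => ⟨fun h i => ?_, fun h => ?_⟩⟩
  · exact ne_top_of_le_ne_top h (PalWidth.pw_factor_le n X i)
  · refine ne_top_of_le_ne_top ?_ upper
    have h₁ : ∑ i, PalWidth.pw (X i) ≠ ⊤ := WithTop.sum_ne_top.2 fun i _ => h i
    have h₂ : ∑ i, PalWidth.numGens n A X i ≠ ⊤ := WithTop.sum_ne_top.2 fun i _ => hm i
    exact WithTop.add_ne_top.2 ⟨h₁, WithTop.mul_ne_top (ENat.natCast_ne_top 3) h₂⟩
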